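/- **Setting.** Let $\sigma_{\mathrm{ar}}$ be the signature with the constant $0$, the unary function symbol $S$, the binary relation symbol $<$, and a function symbol for every (definition of a) primitive recursive function; let $\mathcal N$ be its standard structure on $\mathbb N$. Let $\sigma\supseteq\sigma_{\mathrm{ar}}$ be a signature. Formulas are built with $\neg,\vee,\forall$ from atomic formulas (including equalities); $\varphi\to\psi:=\neg\varphi\vee\psi$, $\exists x\,\varphi:=\neg\forall x\,\neg\varphi$, $\forall x\le t\,\varphi:=\forall x(\neg(x<t\vee x=t)\vee\varphi)$ with $x$ not occurring in $t$. A formula is *quantifier-free* if all its quantifiers are bounded, and *universal* if it is a quantifier-free formula prefixed by universal quantifiers. Provability is in Shoenfield's calculus for classical logic: the axioms are $\neg\varphi\vee\varphi$, $\forall x\varphi\to\varphi[x:=t]$ ($x$ free for $t$ in $\varphi$) and the equality axioms; the rules are $\varphi\vdash\varphi\vee\psi$; $\varphi\vee\varphi\vdash\varphi$; $(\varphi\vee\psi)\vee\chi\vdash\varphi\vee(\psi\vee\chi)$; $\varphi\vee\psi,\ \neg\varphi\vee\chi\vdash\psi\vee\chi$; and $\varphi\vee\psi\vdash(\forall x\varphi)\vee\psi$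 ($x$ not free in $\psi$). The theory $\mathsf{PA}^\sigma$ has the axioms $\forall x\,\neg(Sx=0)$, $\forall x\forall y(Sx=Sy\to x=y)$, $\forall x\,\neg(x<0)$, $\forall x\forall y(x<Sy\leftrightarrow (x<y\vee x=y))$, the defining equations of the primitive recursive function symbols, and induction for all $\sigma$-formulas. The finite types are generated from $0$ by $\rho\to\tau$; $\mathbb N_0=\mathbb N$ and $\mathbb N_{\rho\to\tau}=\mathbb N_\tau^{\mathbb N_\rho}$. The *$\omega$-terms* are generated from: countably many variables of each type (those of type $0$ being the first-order variables); a constant $f$ of type $0^n\to0$ for every $n$-ary function symbol $f$ of $\sigma$ that is not one of the primitive recursive function symbols (so $0$ and $S$ have constants); a constant $c_\varphi$ of type $0^{m+2}\to 0$ for every quantifier-free $\sigma$-formula $\varphi$ with $m$ free variables that contains a symbol not in $\sigma_{\mathrm{ar}}$; by abstraction $\lambda x.t$, application $ts$, and infinite sequences: if $t_n$ has type $\rho$ for all $n\in\mathbb N$, then $(t_n)_{n\in\mathbb N}$ has type $0\to\rho$. *$\omega$-formulas* are built with $\neg,\vee,\forall$ (over variables of all types) from equalities of $\omega$-terms of type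 $0$ and relation symbols of $\sigma$ applied to $\omega$-terms of type $0$. If $\mathcal M$ is a $\sigma$-structure whose $\sigma_{\mathrm{ar}}$-reduct is $\mathcal N$, these have their natural semantics over $(\mathbb N_\rho)_\rho$, where $c_\varphi a_1\dots a_m b_1 b_2$ is $b_1$ if $\varphi(a_1,\dots,a_m)$ is true in $\mathcal M$ and $b_2$ otherwise (free variables taken in order of first appearance), and $(t_n)_n$ applied to $k$ is the value of $t_k$; truth is denoted by $\models^\omega$. Finally, $\iota$ is the natural embedding of $\sigma$-formulas into $\omega$-formulas, which sends primitive recursive function symbols to the corresponding closed $\omega$-terms built by $\lambda$-abstraction and the recursors $R_{a,b}=(t_n)_n$, $t_0=a$, $t_{n+1}=b\,\underline n\,t_n$. **Lemma.** From every formal proof $P$ (a finite derivation, some of whose leaves are non-logical axioms) one can extract a closed $\omega$-term $t_P$ of type $0$, determined by $P$ alone, such that the following holds. Let $\Gamma$ be a set of universal $\sigma$-sentences, let $A$ be a quantifier-free $\sigma$-formula whose only free variable, if any, is $x$, and let $P$ be a proof of $\exists x A$ from $\mathsf{PA}^\sigma+\Gamma$. Then for every $\sigma$-structure $\mathcal M$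 whose $\sigma_{\mathrm{ar}}$-reduct is $\mathcal N$ and with $\mathcal M\models\Gamma$, $$\mathcal M\models^\omega\iota(A)[x:=t_P].$$ -/

import Mathlib

universe u v

namespace OmegaCalc

/-! ### Signatures -/

/-- Definitions of primitive recursive functions; there is one function symbol for each of them. -/
inductive PRCode : ℕ → Type
  | zero : PRCode 0
  | succ : PRCode 1
  | proj {n : ℕ} (i : Fin n) : PRCode n
  | comp {m n : ℕ} (f : PRCode m) (g : Fin m → PRCode n) : PRCode n
  | prec {n : ℕ} (f : PRCode n) (g : PRCode (n + 2)) : PRCode (n + 1)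

/-- The function defined by a code. In `prec f g` the recursion is on the first argument. -/
def PRCode.eval : {n : ℕ} → PRCode n → (Fin n → ℕ) → ℕ
  | _, .zero, _ => 0
  | _, .succ, a => a 0 + 1
  | _, .proj i, a => a i
  | _, .comp f g, a => f.eval fun i => (g i).eval a
  | _, .prec f g, a =>
      Nat.rec (f.eval (Fin.tail a))
        (fun y r => g.eval (Fin.cons y (Fin.cons r (Fin.tail a)))) (a 0)

/-- Function symbols of arithmetic: `0`, `S`, and the primitive recursive function symbols. -/
inductive ArFunc : ℕ → Type
  | zero : ArFunc 0
  | succ : ArFunc 1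
  | pr {n : ℕ} (c : PRCode n) : ArFunc n

/-- The only relation symbol of arithmetic (equality is a logical symbol). -/
inductive ArRel : ℕ → Type
  | lt : ArRel 2

/-- The signature of arithmetic. -/
abbrev arith : FirstOrder.Language.{0, 0} := ⟨ArFunc, ArRel⟩

/-- The standard structure on `ℕ`. -/
@[reducible] def stdArith : arith.Structure ℕ where
  funMap {_} f a :=
    match f with
    | .zero => 0
    | .succ => a 0 + 1
    | .pr c => c.eval a
  RelMap {_} r a :=
    match r with
    | .lt => a 0 < a 1

/-- The signature `σ` extending that of arithmetic by the symbols of `L`. Every signature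
containing the one of arithmetic is of this form. -/
abbrev sig (L : FirstOrder.Language.{u, v}) : FirstOrder.Language.{u, v} := arith.sum L

/-- First-order terms; the first-order variables are the natural numbers. -/
abbrev Tm (L : FirstOrder.Language.{u, v}) : Type u := (sig L).Term ℕ

variable {L : FirstOrder.Language.{u, v}}

/-- The `σ`-structure `M`, of universe `ℕ`, has the standard structure as its arithmetical reduct. -/
def IsStandard (M : (sig L).Structure ℕ) : Prop :=
  @FirstOrder.Language.LHom.reduct arith (sig L) FirstOrder.Language.LHom.sumInl ℕ M = stdArith

namespace Tm

def x (n : ℕ) : Tm L := FirstOrder.Language.Term.var n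

def zero : Tm L :=
  FirstOrder.Language.Term.func (L := sig L) (l := 0) (Sum.inl ArFunc.zero) Fin.elim0

def succ (t : Tm L) : Tm L :=
  FirstOrder.Language.Term.func (L := sig L) (l := 1) (Sum.inl ArFunc.succ) fun _ => t

def pr {n : ℕ} (c : PRCode n) (ts : Fin n → Tm L) : Tm L :=
  FirstOrder.Language.Term.func (L := sig L) (Sum.inl (ArFunc.pr c)) ts

/-- The variable occurrences of a term, from left to right. -/
def occ : Tm L → List ℕ
  | .var n => [n]
  | .func _ ts => (List.ofFn fun i => occ (ts i)).flatten

/-- `t[x := s]`. -/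
def subst (t : Tm L) (x : ℕ) (s : Tm L) : Tm L :=
  FirstOrder.Language.Term.subst t (Function.update FirstOrder.Language.Term.var x s)

/-- All symbols of the term are symbols of arithmetic. -/
def IsArith : Tm L → Prop
  | .var _ => True
  | .func f ts => f.isLeft = true ∧ ∀ i, IsArith (ts i)

/-- The value of a term. -/
def val (M : (sig L).Structure ℕ) (e : ℕ → ℕ) (t : Tm L) : ℕ :=
  @FirstOrder.Language.Term.realize (sig L) ℕ M ℕ e t

end Tm

/-! ### First-order formulas -/

/-- First-order `σ`-formulas, built with `¬`, `∨` and `∀`. -/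
inductive Fml (L : FirstOrder.Language.{u, v}) : Type (max u v)
  | eq (t s : Tm L) : Fml L
  | rel {n : ℕ} (R : (sig L).Relations n) (ts : Fin n → Tm L) : Fml L
  | neg (φ : Fml L) : Fml L
  | or (φ ψ : Fml L) : Fml L
  | all (x : ℕ) (φ : Fml L) : Fml L

namespace Fml

def imp (φ ψ : Fml L) : Fml L := or (neg φ) ψ

def and (φ ψ : Fml L) : Fml L := neg (or (neg φ) (neg ψ))

def iff (φ ψ : Fml L) : Fml L := and (imp φ ψ) (imp ψ φ)

def ex (x : ℕ) (φ : Fml L) : Fml L := neg (all x (neg φ))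

def lt (t s : Tm L) : Fml L := rel (n := 2) (Sum.inl ArRel.lt) ![t, s]

def le (t s : Tm L) : Fml L := or (lt t s) (eq t s)

/-- The bounded quantification `∀ x ≤ t, φ`. -/
def ball (x : ℕ) (t : Tm L) (φ : Fml L) : Fml L := all x (imp (le (Tm.x x) t) φ)

/-- `∀ x₀ … ∀ xₙ₋₁, φ`. -/
def alls : ℕ → Fml L → Fml L
  | 0, φ => φ
  | n + 1, φ => alls n (all n φ)

/-- `φ₁ → (… → (φₙ → ψ))`. -/
def imps {n : ℕ} (φ : Fin n → Fml L) (ψ : Fml L) : Fml L := (List.ofFn φ).foldr imp ψ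

/-- The free occurrences of variables in a formula, from left to right. -/
def occ : Fml L → List ℕ
  | eq t s => t.occ ++ s.occ
  | rel _ ts => (List.ofFn fun i => (ts i).occ).flatten
  | neg φ => φ.occ
  | or φ ψ => φ.occ ++ ψ.occ
  | all x φ => φ.occ.filter (· ≠ x)

/-- The free variables of a formula. -/
def fv (φ : Fml L) : Set ℕ := {x | x ∈ φ.occ}

/-- The free variables of a formula in order of their first appearance, without repetitions
(`List.dedup` keeps last occurrences, whence the two reversals). -/
def fvList (φ : Fml L) : List ℕ := φ.occ.reverse.dedup.reverse

def IsSentence (φ : Fml L) : Prop := φ.fv = ∅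

/-- `φ[x := t]`, without renaming of bound variables; to be used when `x` is free for `t`. -/
def subst (x : ℕ) (t : Tm L) : Fml L → Fml L
  | eq s s' => eq (s.subst x t) (s'.subst x t)
  | rel R ts => rel R fun i => (ts i).subst x t
  | neg φ => neg (subst x t φ)
  | or φ ψ => or (subst x t φ) (subst x t ψ)
  | all y φ => if y = x then all y φ else all y (subst x t φ)

/-- `x` is free for `t` in the formula. -/
def FreeFor (x : ℕ) (t : Tm L) : Fml L → Prop
  | eq _ _ => True
  | rel _ _ => True
  | neg φ => FreeFor x t φ
  | or φ ψ => FreeFor x t φ ∧ FreeFor x t ψ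
  | all y φ => x ∉ (all y φ).fv ∨ (y ∉ t.occ ∧ FreeFor x t φ)

/-- Quantifier-free formulas: all quantifiers are bounded. -/
inductive IsQF : Fml L → Prop
  | eq (t s : Tm L) : IsQF (eq t s)
  | rel {n : ℕ} (R : (sig L).Relations n) (ts : Fin n → Tm L) : IsQF (rel R ts)
  | neg {φ : Fml L} : IsQF φ → IsQF (neg φ)
  | or {φ ψ : Fml L} : IsQF φ → IsQF ψ → IsQF (or φ ψ)
  | ball (x : ℕ) (t : Tm L) {φ : Fml L} : x ∉ t.occ → IsQF φ → IsQF (ball x t φ)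

/-- Universal formulas: quantifier-free formulas prefixed by universal quantifiers. -/
inductive IsUniversal : Fml L → Prop
  | qf {φ : Fml L} : IsQF φ → IsUniversal φ
  | all (x : ℕ) {φ : Fml L} : IsUniversal φ → IsUniversal (all x φ)

/-- All symbols of the formula are symbols of arithmetic. -/
def IsArith : Fml L → Prop
  | eq t s => t.IsArith ∧ s.IsArith
  | rel R ts => R.isLeft = true ∧ ∀ i, (ts i).IsArith
  | neg φ => φ.IsArith
  | or φ ψ => φ.IsArith ∧ ψ.IsArith
  | all _ φ => φ.IsArith

/-- Truth of a formula in a structure with universe `ℕ`, under a valuation. -/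
def Holds (M : (sig L).Structure ℕ) : (ℕ → ℕ) → Fml L → Prop
  | e, eq t s => t.val M e = s.val M e
  | e, rel R ts => @FirstOrder.Language.Structure.RelMap (sig L) ℕ M _ R fun i => (ts i).val M e
  | e, neg φ => ¬ Holds M e φ
  | e, or φ ψ => Holds M e φ ∨ Holds M e ψ
  | e, all x φ => ∀ a : ℕ, Holds M (Function.update e x a) φ

end Fml

/-- `M ⊨ Γ`. -/
def Models (M : (sig L).Structure ℕ) (Γ : Set (Fml L)) : Prop :=
  ∀ φ ∈ Γ, ∀ e : ℕ → ℕ, φ.Holds M e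

/-! ### Proofs -/

open Fml in
/-- Formal proofs (as trees) of a formula in Shoenfield's calculus. Non-logical axioms may occur
anywhere as leaves; `Proof.leaves` collects them. -/
inductive Proof : Fml L → Type (max u v)
  | ax (φ : Fml L) : Proof φ
  | em (φ : Fml L) : Proof (or (neg φ) φ)
  | inst (x : ℕ) (φ : Fml L) (t : Tm L) (h : φ.FreeFor x t) :
      Proof (imp (all x φ) (φ.subst x t))
  | eqRefl (x : ℕ) : Proof (eq (Tm.x x) (Tm.x x))
  | eqFunc {n : ℕ} (f : (sig L).Functions n) (x y : Fin n → ℕ) :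
      Proof (imps (fun i => eq (Tm.x (x i)) (Tm.x (y i)))
        (eq (FirstOrder.Language.Term.func f fun i => Tm.x (x i)) (FirstOrder.Language.Term.func f fun i => Tm.x (y i))))
  | eqRel {n : ℕ} (R : (sig L).Relations n) (x y : Fin n → ℕ) :
      Proof (imps (fun i => eq (Tm.x (x i)) (Tm.x (y i)))
        (imp (rel R fun i => Tm.x (x i)) (rel R fun i => Tm.x (y i))))
  | eqEq (x y : Fin 2 → ℕ) :
      Proof (imps (fun i => eq (Tm.x (x i)) (Tm.x (y i)))
        (imp (eq (Tm.x (x 0)) (Tm.x (x 1))) (eq (Tm.x (y 0)) (Tm.x (y 1)))))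
  | expand {φ : Fml L} (ψ : Fml L) : Proof φ → Proof (or φ ψ)
  | contract {φ : Fml L} : Proof (or φ φ) → Proof φ
  | assoc {φ ψ χ : Fml L} : Proof (or (or φ ψ) χ) → Proof (or φ (or ψ χ))
  | cut {φ ψ χ : Fml L} : Proof (or φ ψ) → Proof (or (neg φ) χ) → Proof (or ψ χ)
  | gen {φ ψ : Fml L} (x : ℕ) (h : x ∉ ψ.fv) : Proof (or φ ψ) → Proof (or (all x φ) ψ)

/-- The non-logical axioms used in a proof. -/
def Proof.leaves : {χ : Fml L} → Proof χ → Set (Fml L)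
  | _, .ax φ => {φ}
  | _, .em _ => ∅
  | _, .inst _ _ _ _ => ∅
  | _, .eqRefl _ => ∅
  | _, .eqFunc _ _ _ => ∅
  | _, .eqRel _ _ _ => ∅
  | _, .eqEq _ _ => ∅
  | _, .expand _ p => p.leaves
  | _, .contract p => p.leaves
  | _, .assoc p => p.leaves
  | _, .cut p q => p.leaves ∪ q.leaves
  | _, .gen _ _ p => p.leaves

open Fml in
/-- The axioms of arithmetic, with induction for all `σ`-formulas. -/
inductive IsPA : Fml L → Prop
  | succ_ne_zero : IsPA (all 0 (neg (eq (Tm.x 0).succ Tm.zero)))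
  | succ_inj : IsPA (all 0 (all 1
      (imp (eq (Tm.x 0).succ (Tm.x 1).succ) (eq (Tm.x 0) (Tm.x 1)))))
  | not_lt_zero : IsPA (all 0 (neg (lt (Tm.x 0) Tm.zero)))
  | lt_succ : IsPA (all 0 (all 1
      (iff (lt (Tm.x 0) (Tm.x 1).succ) (le (Tm.x 0) (Tm.x 1)))))
  | pr_zero : IsPA (eq (Tm.pr .zero Fin.elim0) Tm.zero)
  | pr_succ : IsPA (all 0 (eq (Tm.pr .succ fun _ => Tm.x 0) (Tm.x 0).succ))
  | pr_proj {n : ℕ} (i : Fin n) :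
      IsPA (alls n (eq (Tm.pr (.proj i) fun j => Tm.x j) (Tm.x i)))
  | pr_comp {m n : ℕ} (f : PRCode m) (g : Fin m → PRCode n) :
      IsPA (alls n (eq (Tm.pr (.comp f g) fun j => Tm.x j)
        (Tm.pr f fun i => Tm.pr (g i) fun j => Tm.x j)))
  | pr_prec_zero {n : ℕ} (f : PRCode n) (g : PRCode (n + 2)) :
      IsPA (alls n (eq (Tm.pr (.prec f g) (Fin.cons Tm.zero fun j => Tm.x j))
        (Tm.pr f fun j => Tm.x j)))
  | pr_prec_succ {n : ℕ} (f : PRCode n) (g : PRCode (n + 2)) :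
      IsPA (alls (n + 1) (eq (Tm.pr (.prec f g) (Fin.cons (Tm.x n).succ fun j => Tm.x j))
        (Tm.pr g (Fin.cons (Tm.x n)
          (Fin.cons (Tm.pr (.prec f g) (Fin.cons (Tm.x n) fun j => Tm.x j)) fun j => Tm.x j)))))
  | induction (x : ℕ) (φ : Fml L) :
      IsPA (imp (and (φ.subst x Tm.zero) (all x (imp φ (φ.subst x (Tm.x x).succ)))) (all x φ))

/-- The theory `PA^σ`. -/
def PA (L : FirstOrder.Language.{u, v}) : Set (Fml L) := {φ | IsPA φ}

/-! ### `ω`-terms -/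

/-- Finite types. -/
inductive Ty : Type
  | nat : Ty
  | arr (ρ τ : Ty) : Ty
  deriving DecidableEq

/-- The type `0ⁿ → 0`. -/
@[reducible] def Ty.pow : ℕ → Ty
  | 0 => .nat
  | n + 1 => .arr .nat (Ty.pow n)

/-- The full set-theoretic type structure over `ℕ`. -/
@[reducible] def Ty.Interp : Ty → Type
  | .nat => ℕ
  | .arr ρ τ => ρ.Interp → τ.Interp

/-- Variables of all finite types; those of type `0` are the first-order variables. -/
abbrev OVar : Type := Ty × ℕ

/-- The `ω`-terms. The constants are: the function symbols that are not primitive recursive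
function symbols (`0`, `S` and the function symbols of `L`), and a case distinction constant for
each quantifier-free formula which contains a non-arithmetical symbol. -/
inductive OTm (L : FirstOrder.Language.{u, v}) : Ty → Type (max u v)
  | var (x : OVar) : OTm L x.1
  | zero : OTm L .nat
  | succ : OTm L (Ty.pow 1)
  | fn {n : ℕ} (f : L.Functions n) : OTm L (Ty.pow n)
  | case (φ : Fml L) (hqf : φ.IsQF) (hna : ¬ φ.IsArith) : OTm L (Ty.pow (φ.fvList.length + 2))
  | lam (x : OVar) {τ : Ty} (t : OTm L τ) : OTm L (.arr x.1 τ)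
  | app {ρ τ : Ty} (t : OTm L (.arr ρ τ)) (s : OTm L ρ) : OTm L τ
  | seq {ρ : Ty} (t : ℕ → OTm L ρ) : OTm L (.arr .nat ρ)

namespace OTm

/-- The free variables of an `ω`-term. -/
def fv : {ρ : Ty} → OTm L ρ → Set OVar
  | _, var x => {x}
  | _, zero => ∅
  | _, succ => ∅
  | _, fn _ => ∅
  | _, case _ _ _ => ∅
  | _, lam x t => t.fv \ {x}
  | _, app t s => t.fv ∪ s.fv
  | _, seq t => ⋃ n, (t n).fv

end OTm

/-- Closed `ω`-terms of type `ρ`. -/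
def ClosedOTm (L : FirstOrder.Language.{u, v}) (ρ : Ty) : Type (max u v) := {t : OTm L ρ // t.fv = ∅}

namespace OTm

/-- `t[x := s]` for a closed term `s` (so that no variable can be captured). -/
def subst (x : OVar) (s : ClosedOTm L x.1) : {ρ : Ty} → OTm L ρ → OTm L ρ
  | _, var y => if h : x = y then h ▸ s.1 else var y
  | _, zero => zero
  | _, succ => succ
  | _, fn f => fn f
  | _, case φ hqf hna => case φ hqf hna
  | _, lam y t => if x = y then lam y t else lam y (t.subst x s)
  | _, app t r => app (t.subst x s) (r.subst x s)
  | _, seq t => seq fun n => (t n).subst x s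

/-- The first-order variable `n` as a term. -/
def x (n : ℕ) : OTm L .nat := var (.nat, n)

/-- The numeral `S … S 0`. -/
def num : ℕ → OTm L .nat
  | 0 => zero
  | n + 1 => app succ (num n)

/-- The recursor `R_{a,b}`. -/
def recursor {ρ : Ty} (a : OTm L ρ) (b : OTm L (.arr .nat (.arr ρ ρ))) : OTm L (.arr .nat ρ) :=
  seq fun n => Nat.rec a (fun k t => app (app b (num k)) t) n

/-- `t s₁ … sₙ`. -/
def apps : {n : ℕ} → OTm L (Ty.pow n) → (Fin n → OTm L .nat) → OTm L .nat
  | 0, t, _ => t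
  | _ + 1, t, s => apps (app t (s 0)) (Fin.tail s)

/-- `λ xₖ. … λ xₖ₊ₙ₋₁. t`. -/
def lams : (k n : ℕ) → OTm L .nat → OTm L (Ty.pow n)
  | _, 0, t => t
  | k, n + 1, t => lam (.nat, k) (lams (k + 1) n t)

/-- The closed `ω`-term of a primitive recursive function symbol:
a composition is sent to `λ x₀ … xₙ₋₁. f (g₁ x₀ … xₙ₋₁) … (gₘ x₀ … xₙ₋₁)`,
a recursion to `λ y x₀ … xₙ₋₁. R_{f x₀ … xₙ₋₁, λ v w. g v w x₀ … xₙ₋₁} y`. -/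
def ofPR : {n : ℕ} → PRCode n → OTm L (Ty.pow n)
  | _, .zero => zero
  | _, .succ => succ
  | n, .proj i => lams 0 n (x i)
  | n, .comp f g => lams 0 n (apps (ofPR f) fun i => apps (ofPR (g i)) fun j => x j)
  | _, .prec (n := n) f g =>
      lam (.nat, n) (lams 0 n (app
        (recursor (apps (ofPR f) fun j => x j)
          (lam (.nat, n + 1) (lam (.nat, n + 2)
            (apps (ofPR g) (Fin.cons (x (n + 1)) (Fin.cons (x (n + 2)) fun j => x j))))))
        (x n)))

/-- The closed `ω`-term of a function symbol of `σ`. -/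
def ofFunc {n : ℕ} : (sig L).Functions n → OTm L (Ty.pow n)
  | .inl .zero => zero
  | .inl .succ => succ
  | .inl (.pr c) => ofPR c
  | .inr f => fn f

end OTm

/-- The embedding `ι` of first-order terms into `ω`-terms of type `0`. -/
def Tm.iota : Tm L → OTm L .nat
  | .var n => OTm.x n
  | .func f ts => OTm.apps (OTm.ofFunc f) fun i => Tm.iota (ts i)

/-- The `ω`-formulas; equality is only between terms of type `0`. -/
inductive OFml (L : FirstOrder.Language.{u, v}) : Type (max u v)
  | eq (t s : OTm L .nat) : OFml L
  | rel {n : ℕ} (R : (sig L).Relations n) (ts : Fin n → OTm L .nat) : OFml L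
  | neg (φ : OFml L) : OFml L
  | or (φ ψ : OFml L) : OFml L
  | all (x : OVar) (φ : OFml L) : OFml L

/-- The embedding `ι` of first-order formulas into `ω`-formulas. -/
def Fml.iota : Fml L → OFml L
  | .eq t s => .eq t.iota s.iota
  | .rel R ts => .rel R fun i => (ts i).iota
  | .neg φ => .neg φ.iota
  | .or φ ψ => .or φ.iota ψ.iota
  | .all x φ => .all (.nat, x) φ.iota

/-- `B[x := s]` for a closed term `s`. -/
def OFml.subst (x : OVar) (s : ClosedOTm L x.1) : OFml L → OFml L
  | .eq t r => .eq (t.subst x s) (r.subst x s)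
  | .rel R ts => .rel R fun i => (ts i).subst x s
  | .neg φ => .neg (φ.subst x s)
  | .or φ ψ => .or (φ.subst x s) (ψ.subst x s)
  | .all y φ => if x = y then .all y φ else .all y (φ.subst x s)

/-! ### Semantics of `ω`-terms and `ω`-formulas -/

/-- Higher-order valuations. -/
abbrev Val : Type := (x : OVar) → x.1.Interp

/-- The element of type `0ⁿ → 0` given by a function of `n` arguments. -/
def curry : (n : ℕ) → ((Fin n → ℕ) → ℕ) → (Ty.pow n).Interp
  | 0, f => f Fin.elim0
  | n + 1, f => fun a => curry n fun v => f (Fin.cons a v)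

/-- The valuation `e` changed to take the value `a i` at the `i`-th entry of `l`. -/
def assign (e : ℕ → ℕ) (l : List ℕ) (a : Fin l.length → ℕ) : ℕ → ℕ := fun y =>
  if h : y ∈ l then a ⟨l.idxOf y, List.idxOf_lt_length_of_mem h⟩ else e y

open Classical in
/-- Value of an `ω`-term. -/
noncomputable def OTm.val (M : (sig L).Structure ℕ) : {ρ : Ty} → OTm L ρ → Val → ρ.Interp
  | _, var x, e => e x
  | _, zero, _ => curry 0 (@FirstOrder.Language.Structure.funMap (sig L) ℕ M 0 (Sum.inl ArFunc.zero))
  | _, succ, _ => curry 1 (@FirstOrder.Language.Structure.funMap (sig L) ℕ M 1 (Sum.inl ArFunc.succ))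
  | _, fn (n := n) f, _ => curry n (@FirstOrder.Language.Structure.funMap (sig L) ℕ M n (Sum.inr f))
  | _, case φ _ _, e => curry (φ.fvList.length + 2) fun a =>
      if φ.Holds M (assign (fun n => e (.nat, n)) φ.fvList fun i => a (i.castAdd 2))
      then a (Fin.natAdd _ (0 : Fin 2)) else a (Fin.natAdd _ (1 : Fin 2))
  | _, lam x t, e => fun a => t.val M (Function.update e x a)
  | _, app t s, e => t.val M e (s.val M e)
  | _, seq t, e => fun n => (t n).val M e

/-- Truth of an `ω`-formula under a higher-order valuation. -/
def OFml.Holds (M : (sig L).Structure ℕ) : Val → OFml L → Prop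
  | e, .eq t s => (t.val M e : ℕ) = s.val M e
  | e, .rel R ts => @FirstOrder.Language.Structure.RelMap (sig L) ℕ M _ R fun i => (ts i).val M e
  | e, .neg φ => ¬ OFml.Holds M e φ
  | e, .or φ ψ => OFml.Holds M e φ ∨ OFml.Holds M e ψ
  | e, .all x φ => ∀ a : x.1.Interp, OFml.Holds M (Function.update e x a) φ

/-- `M ⊨^ω B`, for an `ω`-sentence `B`. -/
def OFml.IsTrue (M : (sig L).Structure ℕ) (B : OFml L) : Prop := ∀ e : Val, B.Holds M e

end OmegaCalc

namespace OmegaCalc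
variable {L : FirstOrder.Language.{u, v}}

/-! ### Standard structures -/

/-! The witness term is not read off from the inference steps. It comes from soundness together with
a well-founded tree of questions about the structure.

A proof uses a finite set Δ of leaves outside `PA L`. Every standard model of Δ satisfies the
arithmetical leaves as well (`IsPA.holds`), hence the conclusion ∃x A (`Proof.sound`). Only
countably many values of non-arithmetical symbols at numerical arguments ("queries") bear on A and
Δ. For each n, finitely many of them decide A(n) (`Fml.IsQF.finDetermined_holds`). If a universal
sentence in Δ fails, finitely many of them refute it (`Fml.IsUniversal.finite_refutation`).

Enumerate these queries and follow an infinite sequence α of answers. Either some finite prefix is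
given by no standard structure, or α defines a standard structure. That structure either violates Δ,
which a finite prefix already shows, or has a witness n, which a finite prefix already verifies. So
the tree of undecided prefixes has no infinite branch. Each query is the value of a closed `ω`-term
(`exists_closedOTm_val_eq_answer`), and branching on its answer is an infinite sequence applied to
that term. Bar induction (`exists_closedOTm_of_bar`) therefore assembles one closed term for all
models. Since Δ consists of leaves of the proof, the term does not depend on Γ or on the structure.
-/

theorem IsStandard.funMap {M : (sig L).Structure ℕ} (hM : IsStandard M) {n : ℕ} (f : ArFunc n)
    (a : Fin n → ℕ) :
    @FirstOrder.Language.Structure.funMap (sig L) ℕ M n (Sum.inl f) a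
      = @FirstOrder.Language.Structure.funMap arith ℕ stdArith n f a := by
  rw [← hM]; rfl

theorem IsStandard.relMap {M : (sig L).Structure ℕ} (hM : IsStandard M) {n : ℕ} (r : ArRel n)
    (a : Fin n → ℕ) :
    @FirstOrder.Language.Structure.RelMap (sig L) ℕ M n (Sum.inl r) a
      ↔ @FirstOrder.Language.Structure.RelMap arith ℕ stdArith n r a := by
  rw [← hM]; rfl

/-! ### First-order semantics -/

/-! ### Values of first-order terms -/

namespace Tm

@[simp] theorem val_var (M : (sig L).Structure ℕ) (e : ℕ → ℕ) (n : ℕ) :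
    Tm.val M e (.var n : Tm L) = e n := rfl

@[simp] theorem val_x (M : (sig L).Structure ℕ) (e : ℕ → ℕ) (n : ℕ) :
    (Tm.x n : Tm L).val M e = e n := rfl

theorem val_func (M : (sig L).Structure ℕ) (e : ℕ → ℕ) {n : ℕ} (f : (sig L).Functions n)
    (ts : Fin n → Tm L) :
    Tm.val M e (.func f ts : Tm L)
      = @FirstOrder.Language.Structure.funMap (sig L) ℕ M n f fun i => (ts i).val M e := rfl

theorem val_zero {M : (sig L).Structure ℕ} (hM : IsStandard M) (e : ℕ → ℕ) :
    (Tm.zero : Tm L).val M e = 0 := hM.funMap _ _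

theorem val_succ {M : (sig L).Structure ℕ} (hM : IsStandard M) (e : ℕ → ℕ) (t : Tm L) :
    t.succ.val M e = t.val M e + 1 := hM.funMap _ _

theorem val_pr {M : (sig L).Structure ℕ} (hM : IsStandard M) (e : ℕ → ℕ) {n : ℕ} (c : PRCode n)
    (ts : Fin n → Tm L) : (Tm.pr c ts).val M e = c.eval fun i => (ts i).val M e := hM.funMap _ _

theorem occ_var (n : ℕ) : Tm.occ (.var n : Tm L) = [n] := by simp [occ]

theorem mem_occ_func {n : ℕ} (f : (sig L).Functions n) (ts : Fin n → Tm L) (y : ℕ) :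
    y ∈ Tm.occ (.func f ts : Tm L) ↔ ∃ i, y ∈ (ts i).occ := by
  simp [occ, List.mem_ofFn]

theorem val_congr (M : (sig L).Structure ℕ) {e e' : ℕ → ℕ} :
    ∀ (t : Tm L), (∀ y ∈ t.occ, e y = e' y) → t.val M e = t.val M e'
  | .var n, h => h n (by simp [occ_var])
  | .func f ts, h => by
    rw [val_func, val_func]
    congr 1
    funext i
    exact val_congr M (ts i) fun y hy => h y ((mem_occ_func f ts y).2 ⟨i, hy⟩)

theorem val_subst (M : (sig L).Structure ℕ) (e : ℕ → ℕ) (t : Tm L) (x : ℕ) (s : Tm L) :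
    (t.subst x s).val M e = t.val M (Function.update e x (s.val M e)) := by
  let := M
  simp only [subst, val, FirstOrder.Language.Term.realize_subst]
  congr 1
  funext y
  by_cases h : y = x
  · subst h; simp
  · simp [h]

theorem val_update_of_notMem (M : (sig L).Structure ℕ) (e : ℕ → ℕ) {t : Tm L} {x : ℕ}
    (h : x ∉ t.occ) (a : ℕ) : t.val M (Function.update e x a) = t.val M e :=
  val_congr M t fun y hy => Function.update_of_ne (by rintro rfl; exact h hy) _ _

end Tm

/-! ### Truth of first-order formulas: locality, substitution, derived connectives -/

namespace Fml

theorem mem_occ_rel {n : ℕ} (R : (sig L).Relations n) (ts : Fin n → Tm L) (y : ℕ) :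
    y ∈ (rel R ts).occ ↔ ∃ i, y ∈ (ts i).occ := by
  simp [occ, List.mem_ofFn]

theorem mem_fv_all (x y : ℕ) (φ : Fml L) : y ∈ (all x φ).fv ↔ y ∈ φ.fv ∧ y ≠ x := by
  simp [fv, occ]

theorem mem_fvList (φ : Fml L) (y : ℕ) : y ∈ φ.fvList ↔ y ∈ φ.fv := by
  simp [fvList, fv]

theorem holds_congr (M : (sig L).Structure ℕ) (φ : Fml L) :
    ∀ {e e' : ℕ → ℕ}, (∀ y ∈ φ.fv, e y = e' y) → (φ.Holds M e ↔ φ.Holds M e') := by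
  induction φ with
  | eq t s =>
    intro e e' h
    simp only [Holds]
    rw [t.val_congr M fun y hy => h y (by simp [fv, occ, hy]),
      s.val_congr M fun y hy => h y (by simp [fv, occ, hy])]
  | rel R ts =>
    intro e e' h
    simp only [Holds]
    have : (fun i => (ts i).val M e) = fun i => (ts i).val M e' := funext fun i =>
      (ts i).val_congr M fun y hy => h y ((mem_occ_rel R ts y).2 ⟨i, hy⟩)
    rw [this]
  | neg φ ih => intro e e' h; exact not_congr (ih h)
  | or φ ψ ih ih' =>
    intro e e' h
    exact or_congr (ih fun y hy => h y (List.mem_append_left _ hy))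
      (ih' fun y hy => h y (List.mem_append_right _ hy))
  | all x φ ih =>
    intro e e' h
    refine forall_congr' fun a => ih fun y hy => ?_
    by_cases hyx : y = x
    · subst hyx; simp
    · simp [hyx, h y ((mem_fv_all x y φ).2 ⟨hy, hyx⟩)]

theorem holds_update_of_notMem (M : (sig L).Structure ℕ) (e : ℕ → ℕ) {φ : Fml L} {x : ℕ}
    (h : x ∉ φ.fv) (a : ℕ) : φ.Holds M (Function.update e x a) ↔ φ.Holds M e :=
  holds_congr M φ fun y hy => Function.update_of_ne (by rintro rfl; exact h hy) _ _

theorem subst_eq_self_of_notMem_tm (x : ℕ) (s : Tm L) :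
    ∀ t : Tm L, x ∉ t.occ → t.subst x s = t
  | .var n, h => by
    have : n ≠ x := fun hn => h (by simp [Tm.occ_var, hn])
    simp [Tm.subst, FirstOrder.Language.Term.subst, this]
  | .func f ts, h => by
    have ih : ∀ i, Tm.subst (ts i) x s = ts i := fun i =>
      subst_eq_self_of_notMem_tm x s (ts i) fun hi => h ((Tm.mem_occ_func f ts x).2 ⟨i, hi⟩)
    simp only [Tm.subst] at ih
    simp [Tm.subst, FirstOrder.Language.Term.subst, ih]

theorem subst_eq_self_of_notMem (x : ℕ) (s : Tm L) (φ : Fml L) :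
    x ∉ φ.fv → φ.subst x s = φ := by
  induction φ with
  | eq t r =>
    intro h
    simp only [fv, occ, Set.mem_ofPred_eq, List.mem_append, not_or] at h
    simp [subst, subst_eq_self_of_notMem_tm, h]
  | rel R ts =>
    intro h
    simp only [subst]
    congr 1
    funext i
    exact subst_eq_self_of_notMem_tm x s _ fun hi => h ((mem_occ_rel R ts x).2 ⟨i, hi⟩)
  | neg φ ih => intro h; simp only [subst]; rw [ih h]
  | or φ ψ ih ih' =>
    intro h
    simp only [subst]
    rw [ih fun hx => h (List.mem_append_left _ hx), ih' fun hx => h (List.mem_append_right _ hx)]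
  | all y φ ih =>
    intro h
    simp only [subst]
    split_ifs with hy
    · rfl
    · rw [ih fun hx => h ((mem_fv_all y x φ).2 ⟨hx, Ne.symm hy⟩)]

/-- At a quantifier there are two cases. If `x` is not free, both sides ignore it; otherwise the
bound variable is not in `t`, and the two updates commute. -/
theorem holds_subst (M : (sig L).Structure ℕ) (x : ℕ) (t : Tm L) (φ : Fml L) :
    ∀ (e : ℕ → ℕ), φ.FreeFor x t →
      ((φ.subst x t).Holds M e ↔ φ.Holds M (Function.update e x (t.val M e))) := by
  induction φ with
  | eq s r => intro e _; simp only [subst, Holds, Tm.val_subst]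
  | rel R ts => intro e _; simp only [subst, Holds, Tm.val_subst]
  | neg φ ih => intro e h; exact not_congr (ih e h)
  | or φ ψ ih ih' => intro e h; exact or_congr (ih e h.1) (ih' e h.2)
  | all y φ ih =>
    intro e h
    by_cases hx : x ∈ (all y φ).fv
    · obtain ⟨hyt, hφ⟩ := h.resolve_left (not_not_intro hx)
      have hyx : y ≠ x := Ne.symm ((mem_fv_all y x φ).1 hx).2
      simp only [subst, if_neg hyx, Holds]
      refine forall_congr' fun a => ?_
      rw [ih _ hφ, Tm.val_update_of_notMem M e hyt, Function.update_comm hyx]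
    · rw [subst_eq_self_of_notMem x t _ hx, holds_update_of_notMem M e hx]

/-- Only a quantifier over `x` could capture, and below it `x` is no longer free. This covers the
terms `0` and `Sx` of the induction axiom. -/
theorem freeFor_of_occ (x : ℕ) (t : Tm L) (ht : ∀ y ∈ t.occ, y = x) (φ : Fml L) :
    φ.FreeFor x t := by
  induction φ with
  | eq _ _ => trivial
  | rel _ _ => trivial
  | neg φ ih => exact ih
  | or φ ψ ih ih' => exact ⟨ih, ih'⟩
  | all y φ ih =>
    by_cases hy : y = x
    · exact Or.inl fun h => ((mem_fv_all y x φ).1 h).2 hy.symm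
    · exact Or.inr ⟨fun h => hy (ht y h), ih⟩

theorem holds_imp {M : (sig L).Structure ℕ} {e : ℕ → ℕ} {φ ψ : Fml L} :
    (imp φ ψ).Holds M e ↔ (φ.Holds M e → ψ.Holds M e) := by
  simp only [imp, Holds]; tauto

theorem holds_and {M : (sig L).Structure ℕ} {e : ℕ → ℕ} {φ ψ : Fml L} :
    (and φ ψ).Holds M e ↔ (φ.Holds M e ∧ ψ.Holds M e) := by
  simp only [and, Holds]; tauto

theorem holds_iff {M : (sig L).Structure ℕ} {e : ℕ → ℕ} {φ ψ : Fml L} :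
    (iff φ ψ).Holds M e ↔ (φ.Holds M e ↔ ψ.Holds M e) := by
  simp only [iff, holds_and, holds_imp]; tauto

theorem holds_ex {M : (sig L).Structure ℕ} {e : ℕ → ℕ} {x : ℕ} {φ : Fml L} :
    (ex x φ).Holds M e ↔ ∃ a, φ.Holds M (Function.update e x a) := by
  simp [ex, Holds]

theorem holds_lt {M : (sig L).Structure ℕ} (hM : IsStandard M) {e : ℕ → ℕ} {t s : Tm L} :
    (lt t s).Holds M e ↔ t.val M e < s.val M e := hM.relMap _ _

theorem holds_le {M : (sig L).Structure ℕ} (hM : IsStandard M) {e : ℕ → ℕ} {t s : Tm L} :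
    (le t s).Holds M e ↔ t.val M e ≤ s.val M e := by
  simp only [le, Holds]
  rw [holds_lt hM]
  exact le_iff_lt_or_eq.symm

/-- Indexing by a `Fin` type exposes a bounded quantifier as a finite conjunction, which is what
finite determination needs. -/
theorem holds_ball {M : (sig L).Structure ℕ} (hM : IsStandard M) {e : ℕ → ℕ} {x : ℕ} {t : Tm L}
    (hx : x ∉ t.occ) {φ : Fml L} :
    (ball x t φ).Holds M e ↔ ∀ a : Fin (t.val M e + 1), φ.Holds M (Function.update e x a) := by
  simp only [ball, Holds, holds_imp, holds_le hM, Tm.val_x, Function.update_self,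
    Tm.val_update_of_notMem M e hx]
  exact ⟨fun h a => h a (Nat.lt_succ_iff.1 a.2), fun h a ha => h ⟨a, Nat.lt_succ_of_le ha⟩⟩

theorem holds_imps {M : (sig L).Structure ℕ} {e : ℕ → ℕ} {n : ℕ} {φ : Fin n → Fml L} {ψ : Fml L} :
    (imps φ ψ).Holds M e ↔ ((∀ i, (φ i).Holds M e) → ψ.Holds M e) := by
  have key : ∀ l : List (Fml L),
      (l.foldr imp ψ).Holds M e ↔ ((∀ χ ∈ l, χ.Holds M e) → ψ.Holds M e) := by
    intro l
    induction l with
    | nil => simp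
    | cons χ l ih => simp [holds_imp, ih]
  rw [imps, key]
  simp [List.mem_ofFn]

theorem holds_alls {M : (sig L).Structure ℕ} {φ : Fml L} (h : ∀ e, φ.Holds M e) :
    ∀ (n : ℕ) (e : ℕ → ℕ), (alls n φ).Holds M e := by
  intro n
  induction n generalizing φ with
  | zero => exact h
  | succ n ih => exact ih fun e a => h _

end Fml

/-! ### Soundness -/

/-- Induction holds even for formulas with new symbols, because the universe is the true ℕ with the
true zero and successor. -/
theorem IsPA.holds {M : (sig L).Structure ℕ} (hM : IsStandard M) {φ : Fml L} (h : IsPA φ) :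
    ∀ e : ℕ → ℕ, φ.Holds M e := by
  have hcons : ∀ {n : ℕ} (e : ℕ → ℕ) (t : Tm L) (ts : Fin n → Tm L),
      (fun i => ((Fin.cons t ts : Fin (n + 1) → Tm L) i).val M e)
        = Fin.cons (t.val M e) fun i => (ts i).val M e := fun e t ts =>
    funext fun i => Fin.cases rfl (fun _ => rfl) i
  cases h with
  | succ_ne_zero =>
    intro e a
    simp [Fml.Holds, Tm.val_succ hM, Tm.val_zero hM]
  | succ_inj =>
    intro e a b
    simp [Fml.holds_imp, Fml.Holds, Tm.val_succ hM]
  | not_lt_zero =>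
    intro e a
    simp [Fml.Holds, Fml.holds_lt hM, Tm.val_zero hM]
  | lt_succ =>
    intro e a b
    simp [Fml.holds_iff, Fml.holds_lt hM, Fml.holds_le hM, Tm.val_succ hM]
  | pr_zero =>
    intro e
    simp [Fml.Holds, Tm.val_pr hM, Tm.val_zero hM, PRCode.eval]
  | pr_succ =>
    intro e a
    simp [Fml.Holds, Tm.val_pr hM, Tm.val_succ hM, PRCode.eval]
  | pr_proj i =>
    refine Fml.holds_alls (fun e => ?_) _
    simp [Fml.Holds, Tm.val_pr hM, PRCode.eval]
  | pr_comp f g =>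
    refine Fml.holds_alls (fun e => ?_) _
    simp [Fml.Holds, Tm.val_pr hM, PRCode.eval]
  | pr_prec_zero f g =>
    refine Fml.holds_alls (fun e => ?_) _
    simp only [Fml.Holds, Tm.val_pr hM, hcons, PRCode.eval]
    simp [Tm.val_zero hM]
  | pr_prec_succ f g =>
    refine Fml.holds_alls (fun e => ?_) _
    simp only [Fml.Holds, Tm.val_pr hM, hcons, PRCode.eval]
    simp [Tm.val_succ hM]
  | induction x φ =>
    intro e
    rw [Fml.holds_imp, Fml.holds_and]
    rintro ⟨h0, hS⟩ a
    have hocc : ∀ y ∈ ((Tm.x x).succ : Tm L).occ, y = x := by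
      intro y hy
      obtain ⟨_, hy⟩ := (Tm.mem_occ_func _ _ y).1 hy
      simpa [Tm.x, Tm.occ_var] using hy
    have hocc0 : ∀ y ∈ (Tm.zero : Tm L).occ, y = x := by
      intro y hy
      obtain ⟨i, _⟩ := (Tm.mem_occ_func _ _ y).1 hy
      exact i.elim0
    induction a with
    | zero =>
      rwa [Fml.holds_subst M x _ φ e (Fml.freeFor_of_occ x _ hocc0 φ), Tm.val_zero hM] at h0
    | succ a ih =>
      have := Fml.holds_imp.1 (hS a) ih
      rwa [Fml.holds_subst M x _ φ _ (Fml.freeFor_of_occ x _ hocc φ), Tm.val_succ hM,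
        Function.update_idem, Tm.val_x, Function.update_self] at this

theorem Proof.sound {M : (sig L).Structure ℕ} {χ : Fml L} (d : Proof χ) :
    (∀ φ ∈ d.leaves, ∀ e : ℕ → ℕ, φ.Holds M e) → ∀ e : ℕ → ℕ, χ.Holds M e := by
  induction d with
  | ax φ => exact fun h => h φ rfl
  | em φ => intro _ e; simp only [Fml.Holds]; tauto
  | inst x φ t h =>
    intro _ e
    rw [Fml.holds_imp, Fml.holds_subst M x t φ e h]
    exact fun h => h _
  | eqRefl x => intro _ e; rfl
  | eqFunc f x y =>
    intro _ e
    rw [Fml.holds_imps]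
    intro h
    simp only [Fml.Holds, Tm.val_x] at h
    simp only [Fml.Holds, Tm.val_func, Tm.val_x, h]
  | eqRel R x y =>
    intro _ e
    rw [Fml.holds_imps]
    intro h
    simp only [Fml.Holds, Tm.val_x] at h
    simp only [Fml.holds_imp, Fml.Holds, Tm.val_x, h, imp_self]
  | eqEq x y =>
    intro _ e
    rw [Fml.holds_imps]
    intro h
    simp only [Fml.Holds, Tm.val_x] at h
    simp only [Fml.holds_imp, Fml.Holds, Tm.val_x, h, imp_self]
  | expand ψ p ih => exact fun h e => Or.inl (ih h e)
  | contract p ih => exact fun h e => (ih h e).elim id id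
  | assoc p ih => exact fun h e => or_assoc.1 (ih h e)
  | cut p q ihp ihq =>
    intro h e
    have h1 := ihp (fun φ hφ => h φ (Or.inl hφ)) e
    have h2 := ihq (fun φ hφ => h φ (Or.inr hφ)) e
    simp only [Fml.Holds] at h1 h2 ⊢
    tauto
  | gen x hx p ih =>
    intro h e
    refine or_iff_not_imp_right.2 fun hψ a => ?_
    exact (ih h _).resolve_right fun h' => hψ ((Fml.holds_update_of_notMem M e hx a).1 h')

theorem Proof.finite_leaves {χ : Fml L} (d : Proof χ) : d.leaves.Finite := by
  induction d <;> simp_all [Proof.leaves]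

/-! ### Semantics of `ω`-terms -/

/-- An element of type `0ⁿ → 0` applied to `n` arguments. -/
def applyPow : (n : ℕ) → (Ty.pow n).Interp → (Fin n → ℕ) → ℕ
  | 0, F, _ => F
  | n + 1, F, a => applyPow n (F (a 0)) (Fin.tail a)

theorem applyPow_curry : ∀ (n : ℕ) (f : (Fin n → ℕ) → ℕ) (a : Fin n → ℕ),
    applyPow n (curry n f) a = f a
  | 0, f, a => congrArg f (Subsingleton.elim _ _)
  | n + 1, f, a => by
    simp only [applyPow, curry]
    rw [applyPow_curry n]
    exact congrArg f (Fin.cons_self_tail a)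

/-- `e` changed to take the values `a 0, …, a (n - 1)` at the first-order variables
`k, …, k + n - 1`. -/
def updateFrom : (k n : ℕ) → Val → (Fin n → ℕ) → Val
  | _, 0, e, _ => e
  | k, n + 1, e, a => updateFrom (k + 1) n (Function.update e (.nat, k) (a 0)) (Fin.tail a)

theorem update_nat_self (e : Val) (k a : ℕ) :
    (Function.update e (.nat, k) a : Val) (.nat, k) = a := Function.update_self _ _ _

theorem update_nat_of_ne (e : Val) {k j : ℕ} (a : ℕ) (h : j ≠ k) :
    (Function.update e (.nat, k) a : Val) (.nat, j) = e (.nat, j) :=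
  Function.update_of_ne (by simpa using h) _ _

theorem updateFrom_of_lt : ∀ (k n : ℕ) (e : Val) (a : Fin n → ℕ) (j : ℕ), j < k →
    updateFrom k n e a (.nat, j) = e (.nat, j)
  | _, 0, _, _, _, _ => rfl
  | k, n + 1, e, a, j, h => by
    rw [updateFrom, updateFrom_of_lt (k + 1) n _ _ j (by omega), update_nat_of_ne e _ h.ne]

theorem updateFrom_of_le : ∀ (k n : ℕ) (e : Val) (a : Fin n → ℕ) (j : ℕ), k + n ≤ j →
    updateFrom k n e a (.nat, j) = e (.nat, j)
  | _, 0, _, _, _, _ => rfl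
  | k, n + 1, e, a, j, h => by
    rw [updateFrom, updateFrom_of_le (k + 1) n _ _ j (by omega), update_nat_of_ne e _ (by omega)]

theorem updateFrom_add : ∀ (k n : ℕ) (e : Val) (a : Fin n → ℕ) (i : Fin n),
    updateFrom k n e a (.nat, k + i) = a i
  | k, n + 1, e, a, i => by
    rw [updateFrom]
    refine Fin.cases ?_ (fun i => ?_) i
    · have := updateFrom_of_lt (k + 1) n (Function.update e (.nat, k) (a 0)) (Fin.tail a) k
        (by omega)
      exact this.trans (update_nat_self e k (a 0))
    · have := updateFrom_add (k + 1) n (Function.update e (.nat, k) (a 0)) (Fin.tail a) i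
      rw [Fin.val_succ, show k + ((i : ℕ) + 1) = k + 1 + i by omega, this]
      rfl

theorem updateFrom_zero (n : ℕ) (e : Val) (a : Fin n → ℕ) (i : Fin n) :
    updateFrom 0 n e a (.nat, (i : ℕ)) = a i := by
  have := updateFrom_add 0 n e a i
  rwa [Nat.zero_add] at this

namespace OTm

theorem val_x (M : (sig L).Structure ℕ) (e : Val) (n : ℕ) :
    (OTm.x n : OTm L .nat).val M e = e (.nat, n) := by
  simp only [OTm.x, val]

theorem val_apps (M : (sig L).Structure ℕ) (e : Val) : ∀ {n : ℕ} (t : OTm L (Ty.pow n))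
    (s : Fin n → OTm L .nat),
    (apps t s).val M e = applyPow n (t.val M e) fun i => (s i).val M e
  | 0, _, _ => rfl
  | n + 1, t, s => by
    rw [apps, val_apps M e (app t (s 0)) (Fin.tail s)]
    simp only [applyPow, val]
    rfl

theorem applyPow_val_lams (M : (sig L).Structure ℕ) (t : OTm L .nat) :
    ∀ (k n : ℕ) (e : Val) (a : Fin n → ℕ),
      applyPow n ((lams k n t).val M e) a = t.val M (updateFrom k n e a)
  | _, 0, _, _ => rfl
  | k, n + 1, e, a => by
    simp only [applyPow, lams, val, updateFrom]
    exact applyPow_val_lams M t (k + 1) n _ _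

theorem val_zero {M : (sig L).Structure ℕ} (hM : IsStandard M) (e : Val) :
    (zero : OTm L .nat).val M e = (0 : ℕ) := by
  simp only [val]
  exact hM.funMap _ _

theorem val_succ {M : (sig L).Structure ℕ} (hM : IsStandard M) (e : Val) (a : ℕ) :
    (succ : OTm L (Ty.pow 1)).val M e a = a + 1 := by
  simp only [val]
  exact hM.funMap _ _

theorem val_num {M : (sig L).Structure ℕ} (hM : IsStandard M) (e : Val) :
    ∀ n : ℕ, (num n : OTm L .nat).val M e = n
  | 0 => val_zero hM e
  | n + 1 => by
    simp only [num, val]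
    rw [val_num hM e n]
    exact val_succ hM e n

/-- Standardness enters because the entries of the recursor contain numerals, which are evaluated in
`M`. -/
theorem val_recursor {M : (sig L).Structure ℕ} (hM : IsStandard M) {ρ : Ty} (a : OTm L ρ)
    (b : OTm L (.arr .nat (.arr ρ ρ))) (e : Val) (m : ℕ) :
    (recursor a b).val M e m
      = Nat.rec (motive := fun _ => ρ.Interp) (a.val M e) (fun k r => b.val M e k r) m := by
  simp only [recursor, val]
  induction m with
  | zero => rfl
  | succ m ih =>
    simp only [val]
    rw [ih, val_num hM]

theorem applyPow_val_ofPR {M : (sig L).Structure ℕ} (hM : IsStandard M) :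
    ∀ {n : ℕ} (c : PRCode n) (e : Val) (a : Fin n → ℕ),
      applyPow n ((ofPR c : OTm L (Ty.pow n)).val M e) a = c.eval a
  | _, .zero, e, a => val_zero hM e
  | _, .succ, e, a => val_succ hM e (a 0)
  | n, .proj i, e, a => by
    rw [ofPR, applyPow_val_lams, val_x, updateFrom_zero, PRCode.eval]
  | n, .comp f g, e, a => by
    simp only [ofPR, applyPow_val_lams, val_apps, applyPow_val_ofPR hM f,
      applyPow_val_ofPR hM (g _), val_x, updateFrom_zero, PRCode.eval]
  | _, .prec (n := n) f g, e, a => by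
    -- The recursion argument is bound at `n` and the step variables at `n + 1` and `n + 2`, all
    -- outside the parameter block `0, …, n - 1`, so the updates do not interfere.
    simp only [ofPR, applyPow, val, applyPow_val_lams]
    rw [val_recursor hM, val_x, updateFrom_of_le 0 n _ _ n (by omega), update_nat_self]
    simp only [val_apps, applyPow_val_ofPR hM f, val_x, updateFrom_zero, PRCode.eval]
    congr 1
    funext k r
    simp only [val, val_apps, applyPow_val_ofPR hM g]
    congr 1
    funext i
    refine Fin.cases ?_ (fun i => Fin.cases ?_ (fun i => ?_) i) i
    · simp only [Fin.cons_zero, val_x]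
      rw [update_nat_of_ne _ _ (by omega), update_nat_self]
    · simp only [Fin.cons_succ, Fin.cons_zero, val_x]
      rw [update_nat_self]
    · simp only [Fin.cons_succ, val_x]
      rw [update_nat_of_ne _ _ (by omega), update_nat_of_ne _ _ (by omega), updateFrom_zero]

theorem applyPow_val_ofFunc {M : (sig L).Structure ℕ} (hM : IsStandard M) {n : ℕ}
    (f : (sig L).Functions n) (e : Val) (a : Fin n → ℕ) :
    applyPow n ((ofFunc f).val M e) a = @FirstOrder.Language.Structure.funMap (sig L) ℕ M n f a := by
  rcases f with f | f
  · rw [hM.funMap]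
    cases f with
    | zero => exact val_zero hM e
    | succ => exact val_succ hM e (a 0)
    | pr c => exact applyPow_val_ofPR hM c e a
  · simp only [ofFunc, val]
    exact applyPow_curry n _ a

end OTm

/-! ### The embedding `ι` preserves values and truth -/

theorem Tm.val_iota {M : (sig L).Structure ℕ} (hM : IsStandard M) (e : Val) :
    ∀ t : Tm L, t.iota.val M e = t.val M fun n => e (.nat, n)
  | .var n => by rw [Tm.iota, OTm.val_x]; rfl
  | .func f ts => by
    rw [Tm.iota, OTm.val_apps, OTm.applyPow_val_ofFunc hM, Tm.val_func]
    congr 1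
    funext i
    exact Tm.val_iota hM e (ts i)

theorem Fml.holds_iota {M : (sig L).Structure ℕ} (hM : IsStandard M) (φ : Fml L) :
    ∀ e : Val, φ.iota.Holds M e ↔ φ.Holds M fun n => e (.nat, n) := by
  induction φ with
  | eq t s => intro e; simp only [Fml.iota, OFml.Holds, Fml.Holds, Tm.val_iota hM]
  | rel R ts => intro e; simp only [Fml.iota, OFml.Holds, Fml.Holds, Tm.val_iota hM]
  | neg φ ih => intro e; exact not_congr (ih e)
  | or φ ψ ih ih' => intro e; exact or_congr (ih e) (ih' e)
  | all x φ ih =>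
    intro e
    refine forall_congr' fun a => (ih _).trans (iff_of_eq ?_)
    congr 1
    funext n
    by_cases h : n = x
    · subst h; rw [update_nat_self, Function.update_self]
    · rw [update_nat_of_ne e a h, Function.update_of_ne h]

/-! ### Substitution of closed terms -/

theorem assign_of_mem {e e' : ℕ → ℕ} {l : List ℕ} (a : Fin l.length → ℕ) {y : ℕ} (h : y ∈ l) :
    assign e l a y = assign e' l a y := by
  simp [assign, h]

theorem OTm.val_congr (M : (sig L).Structure ℕ) {ρ : Ty} (t : OTm L ρ) :
    ∀ {e e' : Val}, (∀ y ∈ t.fv, e y = e' y) → t.val M e = t.val M e' := by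
  induction t with
  | var x => intro e e' h; simp only [val]; exact h x rfl
  | zero => intros; simp only [val]
  | succ => intros; simp only [val]
  | fn f => intros; simp only [val]
  | case φ hqf hna =>
    intro e e' _
    simp only [val]
    congr 1
    funext a
    -- The arguments overwrite every free variable of `φ`, so the ambient valuation does not matter.
    classical exact if_congr (Fml.holds_congr M φ fun y hy =>
      assign_of_mem _ ((Fml.mem_fvList φ y).2 hy)) rfl rfl
  | lam x t ih =>
    intro e e' h
    simp only [val]
    funext a
    refine ih fun y hy => ?_
    by_cases hyx : y = x
    · subst hyx; simp
    · simp [hyx, h y ⟨hy, hyx⟩]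
  | app t s iht ihs =>
    intro e e' h
    simp only [val]
    rw [iht fun y hy => h y (Or.inl hy), ihs fun y hy => h y (Or.inr hy)]
  | seq t ih =>
    intro e e' h
    simp only [val]
    funext n
    exact ih n fun y hy => h y (Set.mem_iUnion.2 ⟨n, hy⟩)

theorem ClosedOTm.val_eq (M : (sig L).Structure ℕ) {ρ : Ty} (s : ClosedOTm L ρ) (e e' : Val) :
    s.1.val M e = s.1.val M e' :=
  OTm.val_congr M s.1 fun y hy => by simp [s.2] at hy

theorem OTm.val_subst (M : (sig L).Structure ℕ) (x : OVar) (s : ClosedOTm L x.1) {ρ : Ty}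
    (t : OTm L ρ) : ∀ e : Val,
      (t.subst x s).val M e = t.val M (Function.update e x (s.1.val M e)) := by
  induction t with
  | var y =>
    intro e
    by_cases h : x = y
    · subst h; simp [subst, val]
    · simp [subst, val, h, Ne.symm h]
  | zero => intros; simp only [subst, val]
  | succ => intros; simp only [subst, val]
  | fn f => intros; simp only [subst, val]
  | case φ hqf hna =>
    intro e
    rw [subst]
    exact val_congr M _ fun y hy => by simp [fv] at hy
  | lam y t ih =>
    intro e
    by_cases h : x = y
    · subst h; simp [subst, val]
    · simp only [subst, if_neg h, val]
      funext a
      rw [ih, s.val_eq M _ e, Function.update_comm h]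
  | app t r iht ihr => intro e; simp only [subst, val]; rw [iht, ihr]
  | seq t ih => intro e; simp only [subst, val]; funext n; exact ih n e

theorem OFml.holds_subst (M : (sig L).Structure ℕ) (x : OVar) (s : ClosedOTm L x.1) (B : OFml L) :
    ∀ e : Val, (B.subst x s).Holds M e ↔ B.Holds M (Function.update e x (s.1.val M e)) := by
  induction B with
  | eq t r => intro e; simp only [subst, Holds, OTm.val_subst]
  | rel R ts => intro e; simp only [subst, Holds, OTm.val_subst]
  | neg φ ih => intro e; exact not_congr (ih e)
  | or φ ψ ih ih' => intro e; exact or_congr (ih e) (ih' e)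
  | all y φ ih =>
    intro e
    by_cases h : x = y
    · subst h; simp [subst, Holds]
    · simp only [subst, if_neg h, Holds]
      refine forall_congr' fun a => ?_
      rw [ih, s.val_eq M _ e, Function.update_comm h]

theorem Fml.holds_iota_subst {M : (sig L).Structure ℕ} (hM : IsStandard M) (A : Fml L) (x : ℕ)
    (s : ClosedOTm L .nat) (e : Val) :
    (A.iota.subst (.nat, x) s).Holds M e
      ↔ A.Holds M (Function.update (fun n => e (.nat, n)) x (s.1.val M e)) := by
  rw [OFml.holds_subst, Fml.holds_iota hM]
  refine iff_of_eq ?_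
  congr 1
  funext n
  by_cases h : n = x
  · subst h; rw [update_nat_self, Function.update_self]
  · rw [update_nat_of_ne e _ h, Function.update_of_ne h]

/-! ### Queries

A query asks for a value of a function symbol, or for the truth value of a relation symbol, of
`L` at given numerical arguments. -/

/-- A symbol of `L` with numerical arguments. -/
abbrev Query (L : FirstOrder.Language.{u, v}) : Type (max u v) :=
  (Σ n, L.Functions n × (Fin n → ℕ)) ⊕ (Σ n, L.Relations n × (Fin n → ℕ))

open Classical in
/-- The answer of a structure to a query; truth values are encoded by `1` and `0`. -/
noncomputable def answer (M : (sig L).Structure ℕ) : Query L → ℕ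
  | .inl ⟨n, f, a⟩ => @FirstOrder.Language.Structure.funMap (sig L) ℕ M n (Sum.inr f) a
  | .inr ⟨n, R, a⟩ =>
      if @FirstOrder.Language.Structure.RelMap (sig L) ℕ M n (Sum.inr R) a then 1 else 0

/-- The standard structure with prescribed answers to all queries. -/
@[reducible] def ofAnswers (α : Query L → ℕ) : (sig L).Structure ℕ where
  funMap {n} f a :=
    match f with
    | .inl f => @FirstOrder.Language.Structure.funMap arith ℕ stdArith n f a
    | .inr f => α (.inl ⟨n, f, a⟩)
  RelMap {n} R a :=
    match R with
    | .inl R => @FirstOrder.Language.Structure.RelMap arith ℕ stdArith n R a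
    | .inr R => α (.inr ⟨n, R, a⟩) = 1

theorem isStandard_ofAnswers (α : Query L → ℕ) : IsStandard (ofAnswers α) := rfl

/-- The hypothesis guarantees a genuine answer: for a relation symbol, an arbitrary `α q` could
differ from both 0 and 1. -/
theorem answer_ofAnswers {α : Query L → ℕ} {q : Query L} {M : (sig L).Structure ℕ}
    (h : α q = answer M q) : answer (ofAnswers α) q = answer M q := by
  rcases q with ⟨n, f, a⟩ | ⟨n, R, a⟩
  · exact h
  · rw [← h]
    have : α (.inr ⟨n, R, a⟩) = 1 ∨ α (.inr ⟨n, R, a⟩) = 0 := by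
      rw [h]; simp only [answer]; split_ifs <;> simp
    rcases this with h1 | h0
    · rw [h1]
      exact if_pos h1
    · rw [h0]
      exact if_neg fun h1 : α (.inr ⟨n, R, a⟩) = 1 => by omega

/-! ### Quantities determined by finitely many queries -/

/-- For standard structures `M`, the value `F M` is determined by the answers of `M` to finitely
many queries from `S`. -/
def FinDetermined (S : Set (Query L)) {β : Type*} (F : (sig L).Structure ℕ → β) : Prop :=
  ∀ M, IsStandard M → ∃ T : Set (Query L), T.Finite ∧ T ⊆ S ∧
    ∀ M', IsStandard M' → (∀ q ∈ T, answer M' q = answer M q) → F M' = F M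

namespace FinDetermined

variable {S S' : Set (Query L)} {β γ : Type*}

theorem mono {F : (sig L).Structure ℕ → β} (hF : FinDetermined S F) (h : S ⊆ S') :
    FinDetermined S' F := fun M hM =>
  let ⟨T, hT, hTS, H⟩ := hF M hM
  ⟨T, hT, hTS.trans h, H⟩

theorem congr {F G : (sig L).Structure ℕ → β} (hF : FinDetermined S F)
    (h : ∀ M, IsStandard M → F M = G M) : FinDetermined S G := fun M hM =>
  let ⟨T, hT, hTS, H⟩ := hF M hM
  ⟨T, hT, hTS, fun M' hM' hT' => by rw [← h M hM, ← h M' hM', H M' hM' hT']⟩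

theorem const (b : β) : FinDetermined S fun _ : (sig L).Structure ℕ => b := fun _ _ =>
  ⟨∅, Set.finite_empty, Set.empty_subset _, fun _ _ _ => rfl⟩

theorem answer {q : Query L} (hq : q ∈ S) : FinDetermined S fun M => OmegaCalc.answer M q :=
  fun _ _ => ⟨{q}, Set.finite_singleton q, Set.singleton_subset_iff.2 hq, fun _ _ h => h q rfl⟩

/-- The later queries may depend on the value of `F`. Agreement on the first finite set fixes that
value, so the second set can be chosen for it. -/
theorem bind {F : (sig L).Structure ℕ → β} {G : β → (sig L).Structure ℕ → γ}
    (hF : FinDetermined S F) (hG : ∀ b, FinDetermined S (G b)) :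
    FinDetermined S fun M => G (F M) M := fun M hM => by
  obtain ⟨T, hT, hTS, H⟩ := hF M hM
  obtain ⟨T', hT', hTS', H'⟩ := hG (F M) M hM
  refine ⟨T ∪ T', hT.union hT', Set.union_subset hTS hTS', fun M' hM' h => ?_⟩
  simp only [H M' hM' fun q hq => h q (Or.inl hq)]
  exact H' M' hM' fun q hq => h q (Or.inr hq)

theorem map {F : (sig L).Structure ℕ → β} (hF : FinDetermined S F) (g : β → γ) :
    FinDetermined S fun M => g (F M) :=
  hF.bind fun b => const (g b)

theorem pi {ι : Type*} [Finite ι] {F : ι → (sig L).Structure ℕ → β}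
    (hF : ∀ i, FinDetermined S (F i)) : FinDetermined S fun M i => F i M := fun M hM => by
  choose T hT hTS H using fun i => hF i M hM
  exact ⟨⋃ i, T i, Set.finite_iUnion hT, Set.iUnion_subset hTS, fun M' hM' h =>
    funext fun i => H i M' hM' fun q hq => h q (Set.mem_iUnion.2 ⟨i, hq⟩)⟩

theorem funMap {n : ℕ} (f : (sig L).Functions n) : ∃ S : Set (Query L), S.Countable ∧
    ∀ a, FinDetermined S fun M => @FirstOrder.Language.Structure.funMap (sig L) ℕ M n f a := by
  rcases f with f | f
  · exact ⟨∅, Set.countable_empty, fun a =>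
      (const _).congr fun M hM => (hM.funMap f a).symm⟩
  · exact ⟨Set.range fun a => .inl ⟨n, f, a⟩, Set.countable_range _, fun a =>
      answer (q := .inl ⟨n, f, a⟩) (Set.mem_range_self a)⟩

theorem relMap {n : ℕ} (R : (sig L).Relations n) : ∃ S : Set (Query L), S.Countable ∧
    ∀ a, FinDetermined S fun M => @FirstOrder.Language.Structure.RelMap (sig L) ℕ M n R a := by
  rcases R with R | R
  · exact ⟨∅, Set.countable_empty, fun a =>
      (const _).congr fun M hM => propext (hM.relMap R a).symm⟩
  · exact ⟨Set.range fun a => .inr ⟨n, R, a⟩, Set.countable_range _, fun a =>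
      ((answer (q := .inr ⟨n, R, a⟩) (Set.mem_range_self a)).map (· = 1)).congr fun M _ => by
        simp [OmegaCalc.answer]⟩

end FinDetermined

/-- The signature may be uncountable, but a term has finitely many symbols, each with countably many
numerical arguments. Hence one countable `S` serves all valuations. -/
theorem Tm.finDetermined_val : ∀ t : Tm L, ∃ S : Set (Query L), S.Countable ∧
    ∀ e : ℕ → ℕ, FinDetermined S fun M => t.val M e
  | .var n => ⟨∅, Set.countable_empty, fun e => .const (e n)⟩
  | .func f ts => by
    choose S hS H using fun i => Tm.finDetermined_val (ts i)
    obtain ⟨S', hS', H'⟩ := FinDetermined.funMap f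
    refine ⟨(⋃ i, S i) ∪ S', (Set.countable_iUnion hS).union hS', fun e => ?_⟩
    exact (FinDetermined.pi fun i => (H i e).mono
      (Set.subset_union_of_subset_left (Set.subset_iUnion S i) S')).bind
        fun a => (H' a).mono Set.subset_union_right

theorem Fml.IsQF.finDetermined_holds {φ : Fml L} (h : φ.IsQF) : ∃ S : Set (Query L), S.Countable ∧
    ∀ e : ℕ → ℕ, FinDetermined S fun M => φ.Holds M e := by
  induction h with
  | eq t s =>
    obtain ⟨S, hS, H⟩ := t.finDetermined_val
    obtain ⟨S', hS', H'⟩ := s.finDetermined_val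
    exact ⟨S ∪ S', hS.union hS', fun e => ((H e).mono Set.subset_union_left).bind
      fun a => ((H' e).mono Set.subset_union_right).map (a = ·)⟩
  | rel R ts =>
    choose S hS H using fun i => (ts i).finDetermined_val
    obtain ⟨S', hS', H'⟩ := FinDetermined.relMap R
    refine ⟨(⋃ i, S i) ∪ S', (Set.countable_iUnion hS).union hS', fun e => ?_⟩
    exact (FinDetermined.pi fun i => (H i e).mono
      (Set.subset_union_of_subset_left (Set.subset_iUnion S i) S')).bind
        fun a => (H' a).mono Set.subset_union_right
  | neg _ ih =>
    obtain ⟨S, hS, H⟩ := ih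
    exact ⟨S, hS, fun e => (H e).map Not⟩
  | or _ _ ih ih' =>
    obtain ⟨S, hS, H⟩ := ih
    obtain ⟨S', hS', H'⟩ := ih'
    exact ⟨S ∪ S', hS.union hS', fun e => ((H e).mono Set.subset_union_left).bind
      fun p => ((H' e).mono Set.subset_union_right).map (p ∨ ·)⟩
  | ball x t hx _ ih =>
    obtain ⟨S, hS, H⟩ := ih
    obtain ⟨S', hS', H'⟩ := t.finDetermined_val
    refine ⟨S ∪ S', hS.union hS', fun e => ?_⟩
    -- The bound is determined first; then finitely many instances remain.
    refine (((H' e).mono Set.subset_union_right).bind fun b =>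
      (FinDetermined.pi fun a : Fin (b + 1) =>
        (H (Function.update e x a)).mono Set.subset_union_left).map fun p => ∀ a, p a).congr
      fun M hM => propext (Fml.holds_ball hM hx).symm

/-- A single false instance refutes a universal formula. Only falsity is finitely determined; truth
may depend on infinitely many queries. -/
theorem Fml.IsUniversal.finite_refutation {φ : Fml L} (h : φ.IsUniversal) :
    ∃ S : Set (Query L), S.Countable ∧ ∀ (M : (sig L).Structure ℕ) (e : ℕ → ℕ), IsStandard M →
      ¬ φ.Holds M e → ∃ T : Set (Query L), T.Finite ∧ T ⊆ S ∧
        ∀ M', IsStandard M' → (∀ q ∈ T, answer M' q = answer M q) → ¬ φ.Holds M' e := by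
  induction h with
  | qf h =>
    obtain ⟨S, hS, H⟩ := h.finDetermined_holds
    refine ⟨S, hS, fun M e hM hφ => ?_⟩
    obtain ⟨T, hT, hTS, HT⟩ := H e M hM
    exact ⟨T, hT, hTS, fun M' hM' h' hφ' => hφ ((HT M' hM' h').mp hφ')⟩
  | all x _ ih =>
    obtain ⟨S, hS, H⟩ := ih
    refine ⟨S, hS, fun M e hM hφ => ?_⟩
    simp only [Fml.Holds, not_forall] at hφ
    obtain ⟨a, ha⟩ := hφ
    obtain ⟨T, hT, hTS, HT⟩ := H M _ hM ha
    exact ⟨T, hT, hTS, fun M' hM' h' hφ' => HT M' hM' h' (hφ' a)⟩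

/-! ### Closed `ω`-terms for queries -/

theorem OTm.fv_apps : ∀ {n : ℕ} (t : OTm L (Ty.pow n)) (s : Fin n → OTm L .nat),
    t.fv = ∅ → (∀ i, (s i).fv = ∅) → (apps t s).fv = ∅
  | 0, _, _, ht, _ => ht
  | n + 1, t, s, ht, hs => by
    rw [apps]
    exact fv_apps _ _ (by rw [fv, ht, hs 0, Set.union_empty]) fun i => hs i.succ

theorem OTm.fv_num : ∀ n : ℕ, (num n : OTm L .nat).fv = ∅
  | 0 => by rw [num, fv]
  | n + 1 => by simp only [num, fv, fv_num n, Set.union_empty]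

/-- The first-order numeral `S … S 0`. -/
def Tm.num : ℕ → Tm L
  | 0 => Tm.zero
  | n + 1 => (Tm.num n).succ

theorem Tm.val_num {M : (sig L).Structure ℕ} (hM : IsStandard M) (e : ℕ → ℕ) :
    ∀ n : ℕ, (Tm.num n : Tm L).val M e = n
  | 0 => Tm.val_zero hM e
  | n + 1 => by rw [Tm.num, Tm.val_succ hM, Tm.val_num hM e n]

/-- A relation query is answered by the case constant of the atomic formula at numerals, applied to
1 and 0. -/
theorem exists_closedOTm_val_eq_answer (q : Query L) : ∃ t : ClosedOTm L .nat,
    ∀ M, IsStandard M → ∀ e : Val, t.1.val M e = answer M q := by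
  rcases q with ⟨n, f, a⟩ | ⟨n, R, a⟩
  · refine ⟨⟨OTm.apps (.fn f) fun i => .num (a i), OTm.fv_apps _ _ (by rw [OTm.fv])
      fun i => OTm.fv_num _⟩, fun M hM e => ?_⟩
    simp only [OTm.val_apps, OTm.val, OTm.val_num hM, applyPow_curry, answer]
  · let φ : Fml L := .rel (Sum.inr R) fun i => Tm.num (a i)
    have hna : ¬ φ.IsArith := fun h => by simp [φ, Fml.IsArith] at h
    let s : Fin (φ.fvList.length + 2) → OTm L .nat :=
      -- The leading zeros fill the slots for free variables; their values are irrelevant, as the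
      -- formula is about numerals.
      Fin.append (fun _ => .num 0) ![.num 1, .num 0]
    refine ⟨⟨OTm.apps (.case φ (.rel _ _) hna) s, OTm.fv_apps _ _ (by rw [OTm.fv])
      fun i => ?_⟩, fun M hM e => ?_⟩
    · refine Fin.addCases (fun i => ?_) (fun i => ?_) i
      · simp only [s, Fin.append_left, OTm.fv_num]
      · simp only [s, Fin.append_right]
        fin_cases i <;> exact OTm.fv_num _
    · have h1 : (s (Fin.natAdd _ (0 : Fin 2))).val M e = (1 : ℕ) := by
        simp only [s, Fin.append_right]; exact OTm.val_num hM e 1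
      have h0 : (s (Fin.natAdd _ (1 : Fin 2))).val M e = (0 : ℕ) := by
        simp only [s, Fin.append_right]; exact OTm.val_num hM e 0
      simp only [OTm.val_apps, OTm.val, applyPow_curry, answer, h1, h0]
      classical refine if_congr ?_ rfl rfl
      simp only [φ, Fml.Holds, Tm.val_num hM]

/-! ### Bar induction -/

/-- The list `s`, latest entry first, records the values of `q 0, …, q (s.length - 1)` at `x`. -/
def Matches {X : Type*} (q : ℕ → X → ℕ) (x : X) : List ℕ → Prop
  | [] => True
  | n :: s => q s.length x = n ∧ Matches q x s

/-- If the values `q 0 M, q 1 M, …` of closed terms bar the predicate `P`, in the sense that along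
each sequence of values some finite initial segment determines an `n` with `P M n`, then such
an `n` is given by a closed `ω`-term. -/
theorem exists_closedOTm_of_bar (q : ℕ → (sig L).Structure ℕ → ℕ)
    (hq : ∀ i, ∃ t : ClosedOTm L .nat, ∀ M, IsStandard M → ∀ e : Val, t.1.val M e = q i M)
    (P : (sig L).Structure ℕ → ℕ → Prop)
    (hbar : ∀ α : ℕ → ℕ, ∃ k n, ∀ M, IsStandard M → (∀ i < k, q i M = α i) → P M n) :
    ∃ t : ClosedOTm L .nat, ∀ M, IsStandard M → ∀ e : Val, P M (t.1.val M e) := by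
  let Secured (s : List ℕ) : Prop := ∃ t : ClosedOTm L .nat,
    ∀ M, IsStandard M → Matches q M s → ∀ e : Val, P M (t.1.val M e)
  have step (s : List ℕ) (h : ∀ n, Secured (n :: s)) : Secured s := by
    choose t ht using h
    obtain ⟨r, hr⟩ := hq s.length
    -- Evaluate the next query and select the term for its answer: this is where infinite sequences
    -- are indispensable.
    refine ⟨⟨.app (.seq fun n => (t n).1) r.1, ?_⟩, fun M hM hs e => ?_⟩
    · simp only [OTm.fv, (t _).2, r.2, Set.iUnion_empty, Set.union_empty]
    · simp only [OTm.val, hr M hM e]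
      exact ht _ M hM ⟨rfl, hs⟩ e
  by_contra hnot
  have hnil : ¬ Secured [] := fun ⟨t, ht⟩ => hnot ⟨t, fun M hM e => ht M hM trivial e⟩
  have hstep (s : List ℕ) : ∃ n, ¬ Secured s → ¬ Secured (n :: s) := by
    by_cases hs : Secured s
    · exact ⟨0, fun h => absurd hs h⟩
    · obtain ⟨n, hn⟩ := not_forall.1 (mt (step s) hs)
      exact ⟨n, fun _ => hn⟩
  choose f hf using hstep
  -- An unsecured root yields an infinite branch of unsecured nodes, which the bar must meet.
  let σ : ℕ → List ℕ := fun k => Nat.rec [] (fun _ s => f s :: s) k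
  have hσ (k : ℕ) : ¬ Secured (σ k) := by
    induction k with
    | zero => exact hnil
    | succ k ih => exact hf _ ih
  have hlen (k : ℕ) : (σ k).length = k := by
    induction k with
    | zero => rfl
    | succ k ih => exact congrArg (· + 1) ih
  have hmatch (M : (sig L).Structure ℕ) (k : ℕ) (h : Matches q M (σ k)) :
      ∀ i < k, q i M = f (σ i) := by
    induction k with
    | zero => intro i hi; omega
    | succ k ih =>
      obtain ⟨h1, h2⟩ := h
      intro i hi
      rcases Nat.lt_succ_iff_lt_or_eq.1 hi with hi | rfl
      · exact ih h2 i hi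
      · have hl := hlen i
        simp only [σ] at hl
        rwa [hl] at h1
  obtain ⟨k, n, hkn⟩ := hbar fun i => f (σ i)
  -- At the bar, a numeral secures the node.
  refine hσ k ⟨⟨.num n, OTm.fv_num n⟩, fun M hM hs e => ?_⟩
  rw [OTm.val_num hM]
  exact hkn M hM (hmatch M k hs)

/-! ### Extraction of the witness term -/

/-- If all standard models of a countable set of universal formulas satisfy `∃ x A` for a
quantifier-free `A`, then some closed `ω`-term is a witness in all of them. -/
theorem exists_closedOTm_witness {Δ : Set (Fml L)} (hΔ : Δ.Countable)
    (hU : ∀ γ ∈ Δ, γ.IsUniversal) {A : Fml L} (hA : A.IsQF) {x : ℕ} (hx : A.fv ⊆ {x})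
    (hex : ∀ M, IsStandard M → Models M Δ → ∀ e : ℕ → ℕ, (A.ex x).Holds M e) :
    ∃ t : ClosedOTm L .nat, ∀ M, IsStandard M → Models M Δ →
      (A.iota.subst (.nat, x) t).IsTrue M := by
  obtain ⟨SA, hSA, HA⟩ := hA.finDetermined_holds
  choose! SU hSU HU using fun γ (hγ : γ ∈ Δ) => (hU γ hγ).finite_refutation
  let S : Set (Query L) := SA ∪ ⋃ γ ∈ Δ, SU γ
  have hS : S.Countable := hSA.union (hΔ.biUnion hSU)
  let C : Set ((sig L).Structure ℕ → ℕ) :=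
    -- The constant 0 keeps the set nonempty, so that it can be enumerated even when no query is
    -- needed.
    insert (fun _ => 0) ((fun q M => answer M q) '' S)
  obtain ⟨q, hq⟩ : ∃ q : ℕ → _, C = Set.range q := ((hS.image _).insert _ : C.Countable).exists_eq_range
    (Set.insert_nonempty _ _)
  have hqC (i : ℕ) : q i ∈ C := by rw [hq]; exact Set.mem_range_self i
  have hqS (r : Query L) (hr : r ∈ S) : ∃ i, q i = fun M => answer M r := by
    have : (fun M => answer M r) ∈ C := Or.inr ⟨r, hr, rfl⟩
    rwa [hq] at this
  let P (M : (sig L).Structure ℕ) (n : ℕ) : Prop :=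
    Models M Δ → A.Holds M (Function.update (fun _ => 0) x n)
  have hbar (α : ℕ → ℕ) :
      ∃ k n, ∀ M, IsStandard M → (∀ i < k, q i M = α i) → P M n := by
    -- A prefix that no standard structure realizes is secured vacuously.
    by_cases hk : ∃ k, ∀ M, IsStandard M → ¬ ∀ i < k, q i M = α i
    · obtain ⟨k, hk⟩ := hk
      exact ⟨k, 0, fun M hM h => absurd h (hk M hM)⟩
    push Not at hk
    choose N hN hNα using hk
    choose! idx hidx using hqS
    -- Now every prefix of `α` is realized, possibly by different structures; `M` realizes all the
    -- answers to queries in `S` at once.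
    let M := ofAnswers fun r => α (idx r)
    have hM : IsStandard M := isStandard_ofAnswers _
    have hans (r : Query L) (hr : r ∈ S) : answer M r = α (idx r) := by
      -- The prefix of length `idx r + 1` is the shortest containing index `idx r`.
      have h : α (idx r) = answer (N (idx r + 1)) r := by
        rw [← hNα (idx r + 1) (idx r) (Nat.lt_succ_self _), hidx r hr]
      rw [h]
      exact answer_ofAnswers h
    -- Finitely many queries all occur in some prefix.
    have bound (T : Set (Query L)) (hT : T.Finite) (hTS : T ⊆ S) : ∃ k, ∀ M',
        (∀ i < k, q i M' = α i) → ∀ r ∈ T, answer M' r = answer M r := by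
      obtain ⟨b, hb⟩ := (hT.image idx).bddAbove
      refine ⟨b + 1, fun M' h r hr => ?_⟩
      have := h (idx r) (Nat.lt_succ_of_le (hb ⟨r, hr, rfl⟩))
      rw [hidx r (hTS hr)] at this
      rw [hans r (hTS hr)]
      exact this
    by_cases hMΔ : Models M Δ
    · obtain ⟨n, hn⟩ := Fml.holds_ex.1 (hex M hM hMΔ fun _ => 0)
      obtain ⟨T, hT, hTS, H⟩ := HA (Function.update (fun _ => 0) x n) M hM
      obtain ⟨k, hk⟩ := bound T hT (hTS.trans Set.subset_union_left)
      exact ⟨k, n, fun M' hM' h _ => (H M' hM' (hk M' h)).mpr hn⟩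
    · simp only [Models, not_forall] at hMΔ
      obtain ⟨γ, hγ, e, he⟩ := hMΔ
      obtain ⟨T, hT, hTS, H⟩ := HU γ hγ M e hM he
      obtain ⟨k, hk⟩ := bound T hT
        ((hTS.trans (Set.subset_biUnion_of_mem hγ)).trans Set.subset_union_right)
      -- The prefix already refutes `γ`, so the witness 0 is arbitrary.
      exact ⟨k, 0, fun M' hM' h hΔ' => absurd (hΔ' γ hγ e) (H M' hM' (hk M' h))⟩
  have hterm (i : ℕ) : ∃ t : ClosedOTm L .nat,
      ∀ M, IsStandard M → ∀ e : Val, t.1.val M e = q i M := by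
    rcases hqC i with h | ⟨r, -, h⟩
    · exact ⟨⟨.num 0, OTm.fv_num 0⟩, fun M hM e => by rw [h]; exact OTm.val_num hM e 0⟩
    · obtain ⟨t, ht⟩ := exists_closedOTm_val_eq_answer r
      exact ⟨t, fun M hM e => by rw [← h]; exact ht M hM e⟩
  obtain ⟨t, ht⟩ := exists_closedOTm_of_bar q hterm P hbar
  refine ⟨t, fun M hM hΔM e => (Fml.holds_iota_subst hM A x t e).2 ?_⟩
  refine (Fml.holds_congr M A fun y hy => ?_).1 (ht M hM e hΔM)
  obtain rfl : y = x := hx hy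
  rw [Function.update_self, Function.update_self]

/-- The witness term depends only on the proof: it can be chosen for the non-logical axioms of
the proof that are not axioms of arithmetic. -/
theorem Proof.exists_closedOTm {χ : Fml L} (d : Proof χ) : ∃ t : ClosedOTm L .nat,
    (∀ φ ∈ d.leaves \ PA L, φ.IsUniversal) → ∀ (A : Fml L) (x : ℕ), A.IsQF → A.fv ⊆ {x} →
      χ = A.ex x → ∀ M, IsStandard M → Models M (d.leaves \ PA L) →
        (A.iota.subst (.nat, x) t).IsTrue M := by
  have sound (M : (sig L).Structure ℕ) (hM : IsStandard M) (h : Models M (d.leaves \ PA L)) :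
      ∀ e : ℕ → ℕ, χ.Holds M e := by
    refine d.sound fun φ hφ => ?_
    by_cases hPA : φ ∈ PA L
    · exact IsPA.holds hM hPA
    · exact h φ ⟨hφ, hPA⟩
  -- The case split concerns only the proof, which keeps the term independent of Γ; a proof of
  -- another form gets a dummy numeral.
  by_cases H : (∀ φ ∈ d.leaves \ PA L, φ.IsUniversal) ∧
      ∃ (A : Fml L) (x : ℕ), A.IsQF ∧ A.fv ⊆ {x} ∧ χ = A.ex x
  · obtain ⟨hU, A, x, hA, hx, rfl⟩ := H
    obtain ⟨t, ht⟩ := exists_closedOTm_witness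
      (d.finite_leaves.subset Set.sdiff_subset).countable hU hA hx sound
    refine ⟨t, fun _ A' x' _ _ h => ?_⟩
    -- The conclusion determines `A` and `x`, so the choice made above is the only one.
    simp only [Fml.ex, Fml.neg.injEq, Fml.all.injEq] at h
    obtain ⟨rfl, rfl⟩ := h
    exact ht
  · exact ⟨⟨.num 0, OTm.fv_num 0⟩, fun hU A x hA hx h => absurd ⟨hU, A, x, hA, hx, h⟩ H⟩

end OmegaCalc

theorem lemma1 (L : FirstOrder.Language.{u, v}) :
    ∃ extract : (χ : OmegaCalc.Fml L) → OmegaCalc.Proof χ → OmegaCalc.ClosedOTm L .nat,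
      ∀ Γ : Set (OmegaCalc.Fml L), (∀ γ ∈ Γ, γ.IsUniversal ∧ γ.IsSentence) →
      ∀ (A : OmegaCalc.Fml L) (x : ℕ), A.IsQF → A.fv ⊆ {x} →
      ∀ d : OmegaCalc.Proof (A.ex x), d.leaves ⊆ OmegaCalc.PA L ∪ Γ →
      ∀ M : (OmegaCalc.sig L).Structure ℕ, OmegaCalc.IsStandard M → OmegaCalc.Models M Γ →
        (A.iota.subst (.nat, x) (extract (A.ex x) d)).IsTrue M := by
  choose extract hextract using fun (χ : OmegaCalc.Fml L) (d : OmegaCalc.Proof χ) =>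
    d.exists_closedOTm
  refine ⟨extract, fun Γ hΓ A x hA hx d hd M hM hMΓ => ?_⟩
  -- Every model of Γ is thus a model of the leaves from which the term was built.
  have hleaves : d.leaves \ OmegaCalc.PA L ⊆ Γ := Set.sdiff_subset_iff.2 hd
  exact hextract (A.ex x) d (fun φ hφ => (hΓ φ (hleaves hφ)).1) A x hA hx rfl M hM
    fun φ hφ => hMΓ φ (hleaves hφ)
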